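/- Let $d\ge 3$ be an integer, let $\delta<1$ and $c>0$ be real numbers, and let $(p_n)_{n\ge 1}$ be a sequence in $[0,1]$ with $p_n=(c+o(1))\,n^{-d+1+\delta}$ as $n\to\infty$. For each $n$, let $\mathcal H$ be the random $d$-uniform hypergraph on the vertex set $[n]=\{1,\dots,n\}$ in which each $d$-element subset of $[n]$ is a hyperedge independently with probability $p_n$. Let $\Psi=\mathrm{Proj}(\mathcal H)$ be its projection, that is, the graph on $[n]$ in which two distinct vertices are adjacent if and only if some hyperedge of $\mathcal H$ contains both of them. Let $H(\Psi)$ denote the Shannon entropy of $\Psi$ and $H(\mathcal H\mid\Psi)$ the conditional Shannon entropy of $\mathcal H$ given $\Psi$ (natural logarithms). Then, as $n\to\infty$ with $d$, $\delta$, $c$ and the sequence $(p_n)$ fixed, $$H(\Psi)=\Theta\left(n^{1+\delta}\log n\right)$$ and $$H(\mathcal H\mid\Psi)=\begin{cases} o\left(n^{1+\delta}\right) & \text{if } \delta<\frac{d-1}{d+1},\\[2pt] O\left(n^{1+\delta}\right) & \text{if } \delta=\frac{d-1}{d+1},\\[2pt] \Theta\left(n^{1+\delta}\log n\right) & \text{if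 } \delta>\frac{d-1}{d+1}.\end{cases}$$ -/

import Mathlib

open Filter Topology Asymptotics MeasureTheory ProbabilityTheory

noncomputable section

namespace HypergraphProjection

/-- The Shannon entropy (in nats) `H(X) = -∑ₓ Pr[X = x] log Pr[X = x]` of a random variable with
finitely many values. -/
def entropy {Ω S : Type*} [MeasurableSpace Ω] [Fintype S] (μ : Measure Ω) (X : Ω → S) : ℝ :=
  ∑ x : S, Real.negMulLog (μ.real (X ⁻¹' {x}))

/-- The conditional Shannon entropy `H(X | Y) = ∑_y Pr[Y = y] H(X | Y = y)`, where `H(X | Y = y)` is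
the entropy of `X` under the conditional measure given `Y = y`. -/
def condEntropy {Ω S T : Type*} [MeasurableSpace Ω] [Fintype S] [Fintype T] (μ : Measure Ω)
    (X : Ω → S) (Y : Ω → T) : ℝ :=
  ∑ y : T, μ.real (Y ⁻¹' {y}) * entropy (ProbabilityTheory.cond μ (Y ⁻¹' {y})) X

/-- A `d`-uniform hypergraph on the vertex set `Fin n`, given by its set of hyperedges. -/
abbrev UniformHypergraph (n d : ℕ) : Type := Set (Set.powersetCard (Fin n) d)

/-- The law of the random `d`-uniform hypergraph on `Fin n` in which each `d`-subset of the
vertex set is a hyperedge independently with probability `p`. -/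
def hypergraphLaw (n d : ℕ) (p : unitInterval) : Measure (UniformHypergraph n d) :=
  setBernoulli Set.univ p

/-- The projection of a hypergraph: distinct vertices are adjacent if and only if some hyperedge
contains both. -/
def proj {n d : ℕ} (H : UniformHypergraph n d) : SimpleGraph (Fin n) where
  Adj i j := i ≠ j ∧ ∃ h ∈ H, i ∈ (h : Finset (Fin n)) ∧ j ∈ (h : Finset (Fin n))
  symm := ⟨fun _ _ ⟨hij, h, hh, hi, hj⟩ => ⟨hij.symm, h, hh, hj, hi⟩⟩
  loopless := ⟨fun _ h => h.1 rfl⟩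

/-- The entropy `H(Ψ)` of the projection `Ψ = Proj(𝓗)` of the random hypergraph `𝓗`. -/
def projEntropy (n d : ℕ) (p : unitInterval) : ℝ :=
  entropy (hypergraphLaw n d p) (fun H : UniformHypergraph n d => proj H)

/-- The conditional entropy `H(𝓗 | Ψ)` of the random hypergraph `𝓗` given `Ψ = Proj(𝓗)`. -/
def hypergraphCondEntropy (n d : ℕ) (p : unitInterval) : ℝ :=
  condEntropy (hypergraphLaw n d p) (fun H : UniformHypergraph n d => H)
    (fun H : UniformHypergraph n d => proj H)

end HypergraphProjection

end

namespace HypergraphProjection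

/-! ### Finite entropy: Gibbs' inequality and the chain rule. -/

section Entropy

/-! Since Ψ is a function of 𝓗, H(𝓗 | Ψ) = H(𝓗) - H(Ψ), and H(𝓗) is explicit: with N = C(n,d), it is
Np((d-1-δ) log n + O(1)), where Np has order n^(1+δ). So each lower bound follows from an upper
bound on the other entropy, and both upper bounds come from Gibbs' inequality with a binomial weight
of parameter t.

For H(𝓗 | Ψ), every hyperedge is a clique of Ψ, so 𝓗 is encoded as a subset of the d-cliques of Ψ
(`hypergraphCondEntropy_le`). The cost is -log t per hyperedge and -log(1-t) per d-clique that is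
not a hyperedge. Such a clique is covered by the traces of other hyperedges. A family F of traces
occurs with probability O(n^(-∑(|S|-1-δ))), and `IsPairCover.le_sum` bounds this by O(p n^(-γ)) with
γ = 1-δ-2/(d+1), provided γ ≥ 0, that is δ ≤ (d-1)/(d+1). A constant t then suffices: 1/2 at the
threshold, close to 1 below it. For every δ < 1 the crude exponent 1-δ with t = n^(-(d-2)) gives H(𝓗
| Ψ) ≤ Np((d-2) log n + O(1)), which leaves at least Np((1-δ) log n - O(1)) for H(Ψ).

For H(Ψ), comparison with the binomial random graph of density t = n^(-(1-δ)) costs at most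
C(d,2)(1-δ) log n + O(1) per expected hyperedge (`projEntropy_le`). This is below d-1-δ times log n
to leading order exactly when δ > (d-1)/(d+1), which gives the last regime. -/

lemma entropy_id_eq {Ω : Type*} [MeasurableSpace Ω] [Fintype Ω] (μ : Measure Ω) :
    entropy μ (fun x : Ω => x) = ∑ x, Real.negMulLog (μ.real {x}) := rfl

lemma entropy_nonneg {Ω S : Type*} [MeasurableSpace Ω] [Fintype S] (μ : Measure Ω) [IsProbabilityMeasure μ] (X : Ω → S) :
    0 ≤ entropy μ X :=
  Finset.sum_nonneg fun _ _ => Real.negMulLog_nonneg measureReal_nonneg measureReal_le_one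

variable {Ω S T : Type*} [MeasurableSpace Ω] [MeasurableSingletonClass Ω] [Fintype Ω]

open scoped Classical in
lemma measureReal_eq_sum_ite (μ : Measure Ω) [IsFiniteMeasure μ] (s : Set Ω) :
    μ.real s = ∑ x, if x ∈ s then μ.real {x} else 0 := by
  rw [← Finset.sum_filter, sum_measureReal_singleton]
  congr 1
  ext x
  simp

lemma sum_measureReal_singleton_eq_one (μ : Measure Ω) [IsProbabilityMeasure μ] :
    ∑ x, μ.real {x} = 1 := by
  simp [sum_measureReal_singleton]

/-- The law of total expectation over the fibres of a random variable. -/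
lemma sum_measureReal_preimage_mul [Fintype S] (μ : Measure Ω) [IsFiniteMeasure μ] (X : Ω → S)
    (f : S → ℝ) : ∑ s, μ.real (X ⁻¹' {s}) * f s = ∑ x, μ.real {x} * f (X x) := by
  classical
  simp_rw [measureReal_eq_sum_ite μ (X ⁻¹' _), Finset.sum_mul]
  rw [Finset.sum_comm]
  refine Finset.sum_congr rfl fun x _ => ?_
  simp [ite_mul]

open scoped Classical in
/-- The expectation of the number of indices satisfying a random predicate. -/
lemma sum_measureReal_mul_card {ι : Type*} [Fintype ι] (μ : Measure Ω) [IsFiniteMeasure μ]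
    (A : ι → Ω → Prop) :
    ∑ x, μ.real {x} * ((Finset.univ.filter fun i => A i x).card : ℝ) =
      ∑ i, μ.real {x | A i x} := by
  simp_rw [measureReal_eq_sum_ite μ {x | _}]
  rw [Finset.sum_comm]
  refine Finset.sum_congr rfl fun x _ => ?_
  rw [← Finset.sum_filter, Finset.sum_const, nsmul_eq_mul, mul_comm]
  rfl

/-- Pointwise Gibbs: log u ≤ u - 1 at u = b / a. Summed over a probability a and a sub-probability
b, the corrections b - a have nonpositive total. -/
lemma negMulLog_le_of_pos {a b : ℝ} (ha : 0 ≤ a) (hb : 0 < b) :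
    Real.negMulLog a ≤ a * (-Real.log b) + (b - a) := by
  rcases ha.eq_or_lt with rfl | ha
  · simpa using hb.le
  · have h := mul_le_mul_of_nonneg_left (Real.log_le_sub_one_of_pos (div_pos hb ha)) ha.le
    rw [Real.log_div hb.ne' ha.ne', mul_sub, mul_sub, mul_div_cancel₀ _ ha.ne'] at h
    rw [Real.negMulLog]
    linarith

/-- Gibbs' inequality. -/
lemma entropy_le_cross_entropy [Fintype S] (μ : Measure Ω) [IsProbabilityMeasure μ] (X : Ω → S)
    (Q : S → ℝ) (hQ : ∀ s, 0 < Q s) (hsum : ∑ s, Q s ≤ 1) :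
    entropy μ X ≤ ∑ x, μ.real {x} * (-Real.log (Q (X x))) := by
  rw [← sum_measureReal_preimage_mul μ X (fun s => -Real.log (Q s)), entropy]
  have h1 := sum_measureReal_preimage_mul μ X (fun _ => 1)
  simp only [mul_one, sum_measureReal_singleton_eq_one] at h1
  calc _ ≤ ∑ s, (μ.real (X ⁻¹' {s}) * (-Real.log (Q s)) + (Q s - μ.real (X ⁻¹' {s}))) :=
        Finset.sum_le_sum fun s _ => negMulLog_le_of_pos measureReal_nonneg (hQ s)
    _ ≤ _ := by
        rw [Finset.sum_add_distrib, Finset.sum_sub_distrib]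
        linarith

lemma entropy_eq_sum_log [Fintype S] (μ : Measure Ω) [IsFiniteMeasure μ] (X : Ω → S) :
    entropy μ X = ∑ x, μ.real {x} * (-Real.log (μ.real (X ⁻¹' {X x}))) := by
  rw [← sum_measureReal_preimage_mul μ X (fun s => -Real.log (μ.real (X ⁻¹' {s}))), entropy]
  exact Finset.sum_congr rfl fun s _ => by rw [Real.negMulLog]; ring

/-- Gibbs' inequality for conditional entropy. -/
lemma entropy_id_sub_le_cross_entropy [Fintype T] [DecidableEq T] (μ : Measure Ω)
    [IsProbabilityMeasure μ]
    (Y : Ω → T) (Q : Ω → ℝ) (hQ : ∀ x, 0 < Q x)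
    (hsum : ∀ y, ∑ x with Y x = y, Q x ≤ 1) :
    entropy μ (fun x : Ω => x) - entropy μ Y ≤ ∑ x, μ.real {x} * (-Real.log (Q x)) := by
  have hle : ∀ x, μ.real {x} ≤ μ.real (Y ⁻¹' {Y x}) := fun x =>
    measureReal_mono (by simp)
  have h1 := sum_measureReal_preimage_mul μ Y (fun _ => 1)
  simp only [mul_one, sum_measureReal_singleton_eq_one] at h1
  -- The mass of the fibre of x times Q x is a sub-probability on Ω; Gibbs is applied to it, and the
  -- fibre masses reassemble the entropy of Y.
  have h2 : ∑ x, μ.real (Y ⁻¹' {Y x}) * Q x ≤ 1 := by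
    rw [← h1, ← Finset.sum_fiberwise (s := Finset.univ) (g := Y)]
    refine Finset.sum_le_sum fun y _ => ?_
    calc _ = ∑ x with Y x = y, μ.real (Y ⁻¹' {y}) * Q x :=
          Finset.sum_congr rfl fun x hx => by rw [(Finset.mem_filter.1 hx).2]
      _ = μ.real (Y ⁻¹' {y}) * ∑ x with Y x = y, Q x := by rw [Finset.mul_sum]
      _ ≤ _ := mul_le_of_le_one_right measureReal_nonneg (hsum y)
  rw [entropy_eq_sum_log μ Y, entropy_id_eq, sub_le_iff_le_add, ← Finset.sum_add_distrib]
  have key : ∀ x, Real.negMulLog (μ.real {x}) ≤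
      (μ.real {x} * (-Real.log (Q x)) + μ.real {x} * (-Real.log (μ.real (Y ⁻¹' {Y x})))) +
        (μ.real (Y ⁻¹' {Y x}) * Q x - μ.real {x}) := by
    intro x
    rcases (measureReal_nonneg (μ := μ) (s := {x})).eq_or_lt with h0 | h0
    · rw [← h0]
      simpa using mul_nonneg measureReal_nonneg (hQ x).le
    · have hR := h0.trans_le (hle x)
      have := negMulLog_le_of_pos h0.le (mul_pos hR (hQ x))
      rw [Real.log_mul hR.ne' (hQ x).ne'] at this
      linarith
  refine (Finset.sum_le_sum fun x _ => key x).trans ?_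
  rw [Finset.sum_add_distrib, Finset.sum_sub_distrib, sum_measureReal_singleton_eq_one]
  linarith

/-- The chain rule `H(X | Y) = H(X) - H(Y)` when `Y` is a function of `X`. -/
lemma condEntropy_id [Fintype T] (μ : Measure Ω) [IsProbabilityMeasure μ] (Y : Ω → T) :
    condEntropy μ (fun x : Ω => x) Y = entropy μ (fun x : Ω => x) - entropy μ Y := by
  classical
  have hterm : ∀ y x, μ.real (Y ⁻¹' {y}) * Real.negMulLog (μ[|Y ⁻¹' {y}].real {x}) =
      if Y x = y then
        Real.negMulLog (μ.real {x}) + μ.real {x} * Real.log (μ.real (Y ⁻¹' {Y x})) else 0 := by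
    intro y x
    have hc : μ[|Y ⁻¹' {y}].real {x} = (μ.real (Y ⁻¹' {y}))⁻¹ * μ.real (Y ⁻¹' {y} ∩ {x}) := by
      rw [measureReal_def, cond_apply (Set.toFinite _).measurableSet, ENNReal.toReal_mul,
        ENNReal.toReal_inv, ← measureReal_def, ← measureReal_def]
    rw [hc]
    split_ifs with h
    · subst h
      have hi : Y ⁻¹' {Y x} ∩ {x} = {x} := by simp
      rw [hi]
      -- The case of mass zero includes null fibres, where the conditional measure is a default
      -- value; both sides vanish.
      rcases (measureReal_nonneg (μ := μ) (s := {x})).eq_or_lt with h0 | h0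
      · rw [← h0]; simp
      · have hR : 0 < μ.real (Y ⁻¹' {Y x}) := h0.trans_le (measureReal_mono (by simp))
        rw [Real.negMulLog, Real.negMulLog, Real.log_mul (inv_ne_zero hR.ne') h0.ne',
          Real.log_inv]
        field_simp
        ring
    · have hi : Y ⁻¹' {y} ∩ {x} = ∅ := by
        ext z; simp; rintro hz rfl; exact h hz
      simp [hi]
  rw [condEntropy]
  simp_rw [entropy_id_eq, Finset.mul_sum, hterm]
  rw [Finset.sum_comm, entropy_eq_sum_log μ Y, ← Finset.sum_sub_distrib]
  refine Finset.sum_congr rfl fun x _ => ?_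
  simp

/-- A fibre of Y is at least as heavy as any of its points, so its surprisal is no larger. -/
lemma entropy_le_entropy_id [Fintype T] (μ : Measure Ω) [IsProbabilityMeasure μ] (Y : Ω → T) :
    entropy μ Y ≤ entropy μ (fun x : Ω => x) := by
  rw [entropy_eq_sum_log μ Y, entropy_eq_sum_log]
  refine Finset.sum_le_sum fun x _ => ?_
  rcases (measureReal_nonneg (μ := μ) (s := {x})).eq_or_lt with h0 | h0
  · simp [← h0]
  · refine mul_le_mul_of_nonneg_left (neg_le_neg (Real.log_le_log ?_ ?_)) h0.le
    · simpa using h0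
    · exact measureReal_mono (by intro z; simp; rintro rfl; rfl)

end Entropy

/-! ### The random hypergraph, and entropy bounds by binomial coding. -/

section Projection

lemma setBernoulli_univ_real_superset {ι : Type*} [Finite ι] (p : unitInterval) (T : Finset ι) :
    (setBernoulli (Set.univ : Set ι) p).real {x | (T : Set ι) ⊆ x} = (p : ℝ) ^ T.card := by
  have hpre : (fun f : ι → Prop => {i | f i}) ⁻¹' {x | (T : Set ι) ⊆ x} =
      Set.pi (T : Set ι) fun _ => {True} := by
    ext f
    simp [Set.subset_def, Set.mem_pi]
  rw [measureReal_def, setBernoulli_apply', hpre,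
    Measure.infinitePi_pi _ (fun _ _ => MeasurableSet.of_discrete)]
  simp

instance (n d : ℕ) (p : unitInterval) : IsProbabilityMeasure (hypergraphLaw n d p) := by
  unfold hypergraphLaw; infer_instance

lemma card_powersetCard_fin (n d : ℕ) :
    Fintype.card (Set.powersetCard (Fin n) d) = n.choose d := by
  rw [← Nat.card_eq_fintype_card, Set.powersetCard.card, Nat.card_eq_fintype_card, Fintype.card_fin]

variable {n d : ℕ}

lemma hypergraphLaw_real_superset (p : unitInterval) (T : Finset (Set.powersetCard (Fin n) d)) :
    (hypergraphLaw n d p).real {x | (T : Set (Set.powersetCard (Fin n) d)) ⊆ x} =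
      (p : ℝ) ^ T.card :=
  setBernoulli_univ_real_superset p T

lemma hypergraphLaw_real_mem (p : unitInterval) (h : Set.powersetCard (Fin n) d) :
    (hypergraphLaw n d p).real {x | h ∈ x} = p := by
  simpa using hypergraphLaw_real_superset p {h}

open scoped Classical in
/-- The number of hyperedges of a hypergraph. -/
noncomputable def numEdges (x : UniformHypergraph n d) : ℕ := (Finset.univ.filter fun h => h ∈ x).card

lemma sum_hypergraphLaw_mul_numEdges (p : unitInterval) :
    ∑ x, (hypergraphLaw n d p).real {x} * (numEdges x : ℝ) = n.choose d * p := by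
  unfold numEdges
  rw [sum_measureReal_mul_card (hypergraphLaw n d p) (fun h x => h ∈ x)]
  simp_rw [hypergraphLaw_real_mem]
  rw [Finset.sum_const, nsmul_eq_mul, Finset.card_univ, card_powersetCard_fin]

lemma numEdges_le (x : UniformHypergraph n d) : numEdges x ≤ n.choose d := by
  rw [← card_powersetCard_fin]
  exact Finset.card_le_univ _

lemma hypergraphLaw_real_singleton (p : unitInterval) (x : UniformHypergraph n d) :
    (hypergraphLaw n d p).real {x} =
      (p : ℝ) ^ numEdges x * (1 - p : ℝ) ^ (n.choose d - numEdges x) := by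
  classical
  have h1 : x.ncard = numEdges x := by
    rw [Set.ncard_eq_toFinset_card', numEdges]
    congr 1
    ext
    simp
  rw [hypergraphLaw, setBernoulli_real_singleton p (Set.subset_univ _) Set.finite_univ,
    Set.ncard_sdiff (Set.subset_univ _), Set.ncard_univ, Nat.card_eq_fintype_card,
    card_powersetCard_fin, h1]

lemma neg_log_pow_mul_pow {a b : ℝ} (ha : 0 < a) (hb : 0 < b) (k m : ℕ) :
    -Real.log (a ^ k * b ^ m) = k * -Real.log a + m * -Real.log b := by
  rw [Real.log_mul (by positivity) (by positivity), Real.log_pow, Real.log_pow]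
  ring

/-- The entropy `H(𝓗)` of the random hypergraph. -/
lemma entropy_hypergraphLaw {p : unitInterval} (hp0 : 0 < (p : ℝ)) (hp1 : (p : ℝ) < 1) :
    entropy (hypergraphLaw n d p) (fun x : UniformHypergraph n d => x) =
      n.choose d * (p * -Real.log p + (1 - p) * -Real.log (1 - p)) := by
  rw [entropy_eq_sum_log]
  have h : ∀ x : UniformHypergraph n d, (hypergraphLaw n d p).real {x} *
      (-Real.log ((hypergraphLaw n d p).real ((fun x => x) ⁻¹' {x}))) =
      (hypergraphLaw n d p).real {x} * numEdges x * (-Real.log p + Real.log (1 - p)) +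
        (hypergraphLaw n d p).real {x} * (n.choose d * -Real.log (1 - p)) := by
    intro x
    have : (fun x : UniformHypergraph n d => x) ⁻¹' {x} = {x} := rfl
    rw [this]
    conv_lhs => arg 2; rw [hypergraphLaw_real_singleton]
    rw [neg_log_pow_mul_pow hp0 (by linarith), Nat.cast_sub (numEdges_le x)]
    ring
  simp_rw [h]
  rw [Finset.sum_add_distrib, ← Finset.sum_mul, ← Finset.sum_mul, sum_hypergraphLaw_mul_numEdges,
    sum_measureReal_singleton_eq_one]
  ring

lemma adj_proj_of_mem {x : UniformHypergraph n d} {h : Set.powersetCard (Fin n) d} (hx : h ∈ x)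
    {i j : Fin n} (hi : i ∈ (h : Finset (Fin n))) (hj : j ∈ (h : Finset (Fin n))) (hij : i ≠ j) :
    (proj x).Adj i j := ⟨hij, h, hx, hi, hj⟩

open scoped Classical in
/-- A weight of binomial type on the subsets of sets depending on a fibre has total mass at most
one on each fibre. -/
lemma sum_pow_mul_pow_le_one {α ι : Type*} {t : ℝ} (h0 : 0 ≤ t) (h1 : t ≤ 1)
    (A : Finset α) (f : α → Finset ι) (hf : Set.InjOn f A) (K : Finset ι)
    (hK : ∀ a ∈ A, f a ⊆ K) :
    ∑ a ∈ A, t ^ (f a).card * (1 - t) ^ (K.card - (f a).card) ≤ 1 := by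
  rw [← Finset.sum_image (f := fun u : Finset ι => t ^ u.card * (1 - t) ^ (K.card - u.card)) hf]
  calc _ ≤ ∑ u ∈ K.powerset, t ^ u.card * (1 - t) ^ (K.card - u.card) := by
        refine Finset.sum_le_sum_of_subset_of_nonneg ?_ fun u _ _ => ?_
        · intro u hu
          obtain ⟨a, ha, rfl⟩ := Finset.mem_image.1 hu
          exact Finset.mem_powerset.2 (hK a ha)
        · have : 0 ≤ 1 - t := by linarith
          positivity
    _ = 1 := by rw [Finset.sum_pow_mul_eq_add_pow]; simp

/-- An upper bound for `H(𝓗 | Ψ)` in terms of the probability that a `d`-set is a clique of the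
projection without being a hyperedge. -/
lemma hypergraphCondEntropy_le (p : unitInterval) {t q : ℝ} (h0 : 0 < t) (h1 : t < 1)
    (hq : ∀ h : Set.powersetCard (Fin n) d, (hypergraphLaw n d p).real
      {x | h ∉ x ∧ (proj x).IsClique ((h : Finset (Fin n)) : Set (Fin n))} ≤ q) :
    hypergraphCondEntropy n d p ≤
      n.choose d * (p * -Real.log t + q * -Real.log (1 - t)) := by
  classical
  rw [hypergraphCondEntropy, condEntropy_id]
  set μ := hypergraphLaw n d p
  let C : UniformHypergraph n d → Finset (Set.powersetCard (Fin n) d) := fun x =>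
    Finset.univ.filter fun h => h ∉ x ∧ (proj x).IsClique ((h : Finset (Fin n)) : Set (Fin n))
  let Q : UniformHypergraph n d → ℝ := fun x => t ^ numEdges x * (1 - t) ^ (C x).card
  have h1' : 0 < 1 - t := by linarith
  refine (entropy_id_sub_le_cross_entropy μ _ Q (fun x => by positivity) fun G => ?_).trans ?_
  -- The candidates K depend only on G. For x projecting to G the hyperedges form a subset of K with
  -- complement `C x`, so Q is a binomial weight on subsets of K.
  · let K : Finset (Set.powersetCard (Fin n) d) :=
      Finset.univ.filter fun h => G.IsClique ((h : Finset (Fin n)) : Set (Fin n))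
    refine le_trans (le_of_eq ?_) (sum_pow_mul_pow_le_one h0.le h1.le
      (Finset.univ.filter fun x : UniformHypergraph n d => proj x = G)
      (fun x => Finset.univ.filter fun h => h ∈ x) ?_ K ?_)
    · refine Finset.sum_congr rfl fun x hx => ?_
      have hx := (Finset.mem_filter.1 hx).2
      have hsub : (Finset.univ.filter fun h => h ∈ x) ⊆ K := by
        intro h hh
        simp only [Finset.mem_filter, Finset.mem_univ, true_and, K] at hh ⊢
        intro i hi j hj hij
        rw [← hx]
        exact adj_proj_of_mem hh hi hj hij
      rw [← Finset.card_sdiff_of_subset hsub]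
      simp only [Q, numEdges]
      congr 3
      ext h
      simp [C, K, hx, and_comm]
    · intro x _ y _ hxy
      ext h
      simpa using congrArg (h ∈ ·) hxy
    · intro x hx h hh
      simp only [Finset.mem_filter, Finset.mem_univ, true_and, K] at hx hh ⊢
      intro i hi j hj hij
      rw [← hx]
      exact adj_proj_of_mem hh hi hj hij
  · have hs : ∀ x, μ.real {x} * -Real.log (Q x) = μ.real {x} * numEdges x * -Real.log t +
        μ.real {x} * ((C x).card : ℝ) * -Real.log (1 - t) := by
      intro x
      rw [neg_log_pow_mul_pow h0 h1']
      ring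
    simp_rw [hs]
    have hC : ∑ x, μ.real {x} * ((C x).card : ℝ) = ∑ h, μ.real
        {x | h ∉ x ∧ (proj x).IsClique ((h : Finset (Fin n)) : Set (Fin n))} := by
      convert sum_measureReal_mul_card μ fun (h : Set.powersetCard (Fin n) d) x =>
        h ∉ x ∧ (proj x).IsClique ((h : Finset (Fin n)) : Set (Fin n))
    rw [Finset.sum_add_distrib, ← Finset.sum_mul, ← Finset.sum_mul, sum_hypergraphLaw_mul_numEdges,
      hC, mul_add, ← mul_assoc, ← mul_assoc]
    refine add_le_add le_rfl (mul_le_mul_of_nonneg_right ?_ ?_)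
    · refine (Finset.sum_le_sum fun h _ => hq h).trans (le_of_eq ?_)
      rw [Finset.sum_const, nsmul_eq_mul, Finset.card_univ, card_powersetCard_fin]
    · exact neg_nonneg.2 (Real.log_nonpos h1'.le (by linarith))

open scoped Classical in
-- Every edge of the projection is one of the C(d,2) pairs inside some hyperedge.
lemma card_edgeFinset_proj_le (x : UniformHypergraph n d) :
    (proj x).edgeFinset.card ≤ numEdges x * d.choose 2 := by
  have hsub : (proj x).edgeFinset ⊆ (Finset.univ.filter fun h => h ∈ x).biUnion
      fun h => (h : Finset (Fin n)).offDiag.image Sym2.mk.uncurry := by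
    intro e
    induction e with | _ i j
    simp only [SimpleGraph.mem_edgeFinset, SimpleGraph.mem_edgeSet, Finset.mem_biUnion,
      Finset.mem_filter, Finset.mem_univ, true_and, Finset.mem_image, Finset.mem_offDiag]
    rintro ⟨hij, h, hh, hi, hj⟩
    exact ⟨h, hh, (i, j), ⟨hi, hj, hij⟩, rfl⟩
  refine (Finset.card_le_card hsub).trans (Finset.card_biUnion_le_card_mul _ _ _ fun h _ => ?_)
  rw [Sym2.card_image_offDiag, Set.powersetCard.card_eq h]

/-- An upper bound for `H(Ψ)` by comparison with a binomial random graph. -/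
lemma projEntropy_le (p : unitInterval) {t : ℝ} (h0 : 0 < t) (h1 : t < 1) :
    projEntropy n d p ≤ n.choose d * p * d.choose 2 * -Real.log t +
      n.choose 2 * -Real.log (1 - t) := by
  classical
  have h1' : 0 < 1 - t := by linarith
  have hcard : ∀ G : SimpleGraph (Fin n), G.edgeFinset.card ≤ n.choose 2 := fun G => by
    simpa using G.card_edgeFinset_le_card_choose_two
  have hlt : 0 ≤ -Real.log t := neg_nonneg.2 (Real.log_nonpos h0.le h1.le)
  have hlt' : 0 ≤ -Real.log (1 - t) := neg_nonneg.2 (Real.log_nonpos h1'.le (by linarith))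
  -- The law of the binomial random graph with edge density t.
  let Q : SimpleGraph (Fin n) → ℝ := fun G =>
    t ^ G.edgeFinset.card * (1 - t) ^ (n.choose 2 - G.edgeFinset.card)
  refine (entropy_le_cross_entropy (hypergraphLaw n d p) _ Q (fun G => by positivity) ?_).trans ?_
  · have hK : (⊤ : SimpleGraph (Fin n)).edgeFinset.card = n.choose 2 := 
      SimpleGraph.card_edgeFinset_top_eq_card_choose_two.trans (by rw [Fintype.card_fin])
    have := sum_pow_mul_pow_le_one h0.le h1.le (Finset.univ : Finset (SimpleGraph (Fin n)))
      (fun G => G.edgeFinset) (fun G _ G' _ h => SimpleGraph.edgeFinset_inj.1 h)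
      (⊤ : SimpleGraph (Fin n)).edgeFinset
      (fun G _ => SimpleGraph.edgeFinset_mono le_top)
    rwa [hK] at this
  · have hs : ∀ x, (hypergraphLaw n d p).real {x} * -Real.log (Q (proj x)) ≤
        (hypergraphLaw n d p).real {x} * numEdges x * (d.choose 2 * -Real.log t) +
        (hypergraphLaw n d p).real {x} * (n.choose 2 * -Real.log (1 - t)) := by
      intro x
      rw [neg_log_pow_mul_pow h0 h1', mul_assoc, ← mul_add]
      refine mul_le_mul_of_nonneg_left (add_le_add ?_ ?_) measureReal_nonneg
      · rw [← mul_assoc]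
        refine mul_le_mul_of_nonneg_right ?_ hlt
        exact_mod_cast card_edgeFinset_proj_le x
      · exact mul_le_mul_of_nonneg_right (by exact_mod_cast Nat.sub_le _ _) hlt'
    refine (Finset.sum_le_sum fun x _ => hs x).trans (le_of_eq ?_)
    rw [Finset.sum_add_distrib, ← Finset.sum_mul, ← Finset.sum_mul, sum_hypergraphLaw_mul_numEdges,
      sum_measureReal_singleton_eq_one]
    ring

end Projection

/-! ### Pair covers and the probability of a clique that is not a hyperedge. -/

section PairCover

/-- A family of proper subsets of `h` with at least two elements covering all pairs in `h`. -/
structure IsPairCover {α : Type*} (h : Finset α) (F : Finset (Finset α)) : Prop where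
  subset : ∀ S ∈ F, S ⊆ h
  ne : ∀ S ∈ F, S ≠ h
  two_le : ∀ S ∈ F, 2 ≤ S.card
  cover : ∀ i ∈ h, ∀ j ∈ h, i ≠ j → ∃ S ∈ F, i ∈ S ∧ j ∈ S

namespace IsPairCover

variable {α : Type*} {h : Finset α} {F : Finset (Finset α)}

/-- A member S is proper, so it misses some a in h; a pair containing a needs a second member. -/
lemma one_lt_card (hF : IsPairCover h F) (hh : 2 ≤ h.card) : 1 < F.card := by
  obtain ⟨i, hi, j, hj, hij⟩ := Finset.one_lt_card.1 hh
  obtain ⟨S, hS, -⟩ := hF.cover i hi j hj hij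
  obtain ⟨a, ha, haS⟩ := Finset.exists_of_ssubset ((hF.subset S hS).ssubset_of_ne (hF.ne S hS))
  obtain ⟨b, hb, hba⟩ := Finset.exists_mem_ne hh a
  obtain ⟨S', hS', haS', -⟩ := hF.cover a ha b hb hba.symm
  exact Finset.one_lt_card.2 ⟨S, hS, S', hS', fun e => haS (e ▸ haS')⟩

lemma le_sum_card_mul (hF : IsPairCover h F) :
    (h.card : ℝ) * (h.card - 1) ≤ ∑ S ∈ F, (S.card : ℝ) * (S.card - 1) := by
  classical
  have hc : ∀ S : Finset α, (S.offDiag.card : ℝ) = S.card * (S.card - 1) := fun S => by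
    rw [Finset.offDiag_card, Nat.cast_sub (Nat.le_mul_self _)]
    push_cast
    ring
  have hsub : h.offDiag ⊆ F.biUnion fun S => S.offDiag := by
    rintro ⟨i, j⟩ hij
    obtain ⟨hi, hj, hij⟩ := Finset.mem_offDiag.1 hij
    obtain ⟨S, hS, hiS, hjS⟩ := hF.cover i hi j hj hij
    exact Finset.mem_biUnion.2 ⟨S, hS, Finset.mem_offDiag.2 ⟨hiS, hjS, hij⟩⟩
  simp_rw [← hc]
  exact_mod_cast (Finset.card_le_card hsub).trans Finset.card_biUnion_le

/-- Every term is at least 1 - δ > 0, so one member is enough. This crude exponent needs no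
threshold and serves the lower bound on H(Ψ) for all δ < 1. -/
lemma one_sub_le_sum (hF : IsPairCover h F) (hh : 2 ≤ h.card) {δ : ℝ} (hδ : δ < 1) :
    1 - δ ≤ ∑ S ∈ F, ((S.card : ℝ) - 1 - δ) := by
  have h2 : ∀ S ∈ F, 1 - δ ≤ (S.card : ℝ) - 1 - δ := fun S hS => by
    have : (2 : ℝ) ≤ S.card := by exact_mod_cast hF.two_le S hS
    linarith
  obtain ⟨S, hS⟩ := Finset.card_pos.1 ((Nat.zero_lt_one).trans (hF.one_lt_card hh))
  exact (h2 S hS).trans (Finset.single_le_sum (f := fun S : Finset α => (S.card : ℝ) - 1 - δ)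
    (fun T hT => (by linarith : (0 : ℝ) ≤ 1 - δ).trans (h2 T hT)) hS)

/-- The exponent of the expected number of copies of a pair cover. -/
lemma le_sum (hF : IsPairCover h F) (hh : 2 ≤ h.card) {δ : ℝ}
    (hδ : 2 / ((h.card : ℝ) + 1) ≤ 1 - δ) :
    (h.card : ℝ) - 1 - δ + (1 - δ - 2 / (h.card + 1)) ≤ ∑ S ∈ F, ((S.card : ℝ) - 1 - δ) := by
  set d : ℝ := (h.card : ℝ)
  have hd : (2 : ℝ) ≤ d := by simp only [d]; exact_mod_cast hh
  have hd1 : 0 < d + 1 := by linarith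
  set g := 1 - δ - 2 / (d + 1) with hg
  have hm : (2 : ℝ) ≤ F.card := by exact_mod_cast hF.one_lt_card hh
  -- For s = |S| the inequality reduces to (s-2)(d-s) ≥ 0. It trades the linear exponent for the
  -- number of pairs s(s-1), whose sum is controlled by covering.
  have hterm : ∀ S ∈ F, (S.card : ℝ) * (S.card - 1) / (d + 1) + g ≤ (S.card : ℝ) - 1 - δ := by
    intro S hS
    have h2 : (2 : ℝ) ≤ S.card := by exact_mod_cast hF.two_le S hS
    have h3 : (S.card : ℝ) ≤ d := by
      simp only [d]; exact_mod_cast Finset.card_le_card (hF.subset S hS)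
    have : (S.card : ℝ) * (S.card - 1) / (d + 1) ≤ S.card - 2 + 2 / (d + 1) := by
      rw [div_le_iff₀ hd1, add_mul, div_mul_cancel₀ _ hd1.ne']
      nlinarith [mul_nonneg (sub_nonneg.2 h2) (sub_nonneg.2 h3)]
    linarith
  have hsum := Finset.sum_le_sum hterm
  rw [Finset.sum_add_distrib, ← Finset.sum_div, Finset.sum_const, nsmul_eq_mul] at hsum
  have h1 : d * (d - 1) / (d + 1) ≤ (∑ S ∈ F, (S.card : ℝ) * (S.card - 1)) / (d + 1) :=
    div_le_div_of_nonneg_right hF.le_sum_card_mul hd1.le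
  have h2 : d * (d - 1) / (d + 1) = d - 2 + 2 / (d + 1) := by
    field_simp
    ring
  -- The gap g is nonnegative below the threshold and is gained at least twice: one copy completes
  -- d-1-δ, the other is the surplus.
  have h3 : 2 * g ≤ F.card * g := mul_le_mul_of_nonneg_right hm (by linarith)
  linarith

end IsPairCover

variable {n d : ℕ}

open scoped Classical in
-- Such an e contains S and is determined by the d - |S| vertices of e \ S.
lemma card_filter_inter_eq_le (h S : Finset (Fin n)) :
    (Finset.univ.filter fun e : Set.powersetCard (Fin n) d => (e : Finset (Fin n)) ∩ h = S).card ≤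
      n ^ (d - S.card) := by
  refine le_trans ?_ (Nat.choose_le_pow n (d - S.card))
  have hn : n.choose (d - S.card) =
      (Finset.powersetCard (d - S.card) (Finset.univ : Finset (Fin n))).card := by simp
  rw [hn]
  have hsub : ∀ e : Set.powersetCard (Fin n) d, (e : Finset (Fin n)) ∩ h = S →
      S ⊆ (e : Finset (Fin n)) := fun e he => he ▸ Finset.inter_subset_left
  refine Finset.card_le_card_of_injOn (fun e => (e : Finset (Fin n)) \ S) ?_ ?_
  · intro e he
    have he := hsub e (by simpa using he)
    simp only [Finset.mem_coe, Finset.mem_powersetCard]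
    exact ⟨Finset.subset_univ _, by
      rw [Finset.card_sdiff_of_subset he, Set.powersetCard.card_eq]⟩
  · intro e he e' he' hee
    have he := hsub e (by simpa using he)
    have he' := hsub e' (by simpa using he')
    apply Subtype.ext
    have := congrArg (· ∪ S) hee
    simpa [Finset.sdiff_union_of_subset he, Finset.sdiff_union_of_subset he'] using this

/-- The probability that all members of a family of sets occur as traces of hyperedges. -/
lemma hypergraphLaw_real_traces_le (p : unitInterval) (h : Finset (Fin n))
    (F : Finset (Finset (Fin n))) :
    (hypergraphLaw n d p).real {x | ∀ S ∈ F, ∃ e ∈ x, (e : Finset (Fin n)) ∩ h = S} ≤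
      ∏ S ∈ F, ((n : ℝ) ^ (d - S.card) * p) := by
  classical
  let E : F → Finset (Set.powersetCard (Fin n) d) := fun S =>
    Finset.univ.filter fun e => (e : Finset (Fin n)) ∩ h = S
  have hsub : {x : UniformHypergraph n d | ∀ S ∈ F, ∃ e ∈ x, (e : Finset (Fin n)) ∩ h = S} ⊆
      ⋃ f ∈ Fintype.piFinset E, {x | ((Finset.univ.image f : Finset _) : Set _) ⊆ x} := by
    intro x hx
    choose f hf1 hf2 using fun S : F => hx S S.2
    simp only [Set.mem_iUnion]
    refine ⟨f, Fintype.mem_piFinset.2 fun S => by simp [E, hf2 S], ?_⟩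
    intro e he
    simp only [Finset.coe_image, Finset.coe_univ, Set.image_univ, Set.mem_range] at he
    obtain ⟨S, rfl⟩ := he
    exact hf1 S
  -- Distinct traces force distinct hyperedges, so the chosen hyperedges are |F| independent events.
  have hcard : ∀ f ∈ Fintype.piFinset E, (Finset.univ.image f).card = F.card := by
    intro f hf
    rw [Finset.card_image_of_injective, Finset.card_univ, Fintype.card_coe]
    intro S S' hSS
    have h1 := (Finset.mem_filter.1 (Fintype.mem_piFinset.1 hf S)).2
    have h2 := (Finset.mem_filter.1 (Fintype.mem_piFinset.1 hf S')).2
    rw [hSS] at h1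
    exact Subtype.ext (h1.symm.trans h2)
  calc _ ≤ (hypergraphLaw n d p).real
        (⋃ f ∈ Fintype.piFinset E, {x | ((Finset.univ.image f : Finset _) : Set _) ⊆ x}) :=
        measureReal_mono hsub (measure_ne_top _ _)
    _ ≤ ∑ f ∈ Fintype.piFinset E, (hypergraphLaw n d p).real
          {x | ((Finset.univ.image f : Finset _) : Set _) ⊆ x} :=
        measureReal_biUnion_finset_le _ _
    _ = ∑ f ∈ Fintype.piFinset E, (p : ℝ) ^ F.card :=
        Finset.sum_congr rfl fun f hf => by rw [hypergraphLaw_real_superset, hcard f hf]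
    _ = (∏ S : F, ((E S).card : ℝ)) * (p : ℝ) ^ F.card := by
        rw [Finset.sum_const, nsmul_eq_mul, Fintype.card_piFinset, Nat.cast_prod]
    _ ≤ (∏ S : F, (n : ℝ) ^ (d - S.1.card)) * (p : ℝ) ^ F.card := by
        refine mul_le_mul_of_nonneg_right ?_ (pow_nonneg p.2.1 _)
        refine Finset.prod_le_prod (fun _ _ => Nat.cast_nonneg _) fun S _ => ?_
        exact_mod_cast card_filter_inter_eq_le h S.1
    _ = _ := by
        rw [Finset.prod_coe_sort F fun S => (n : ℝ) ^ (d - S.card), Finset.prod_mul_distrib,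
          Finset.prod_const]

open scoped Classical in
-- The cover consists of the traces e ∩ h with at least two vertices. A trace equal to h would force
-- e = h by cardinality, but h is not in x.
lemma exists_isPairCover_of_isClique {x : UniformHypergraph n d} {h : Set.powersetCard (Fin n) d}
    (hx : h ∉ x) (hc : (proj x).IsClique ((h : Finset (Fin n)) : Set (Fin n))) :
    ∃ F : Finset (Finset (Fin n)), IsPairCover (h : Finset (Fin n)) F ∧
      ∀ S ∈ F, ∃ e ∈ x, (e : Finset (Fin n)) ∩ (h : Finset (Fin n)) = S := by
  obtain ⟨F, hmem⟩ : ∃ F : Finset (Finset (Fin n)), ∀ S, S ∈ F ↔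
      ∃ e ∈ x, 2 ≤ S.card ∧ (e : Finset (Fin n)) ∩ (h : Finset (Fin n)) = S :=
    ⟨Finset.univ.filter fun S => ∃ e ∈ x, 2 ≤ S.card ∧
      (e : Finset (Fin n)) ∩ (h : Finset (Fin n)) = S, fun S => by simp⟩
  refine ⟨F, ⟨fun S hS => ?_, fun S hS => ?_, fun S hS => ?_, fun i hi j hj hij => ?_⟩,
    fun S hS => ?_⟩
  rotate_left 4
  · obtain ⟨e, he, -, hS⟩ := (hmem S).1 hS
    exact ⟨e, he, hS⟩
  · obtain ⟨e, -, -, rfl⟩ := (hmem S).1 hS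
    exact Finset.inter_subset_right
  · obtain ⟨e, he, -, rfl⟩ := (hmem S).1 hS
    intro heq
    have : h = e := Set.powersetCard.eq_iff_subset.2 (Finset.inter_eq_right.1 heq)
    exact hx (this ▸ he)
  · obtain ⟨e, -, h2, -⟩ := (hmem S).1 hS
    exact h2
  · obtain ⟨-, e, he, hie, hje⟩ := hc hi hj hij
    have hi' := Finset.mem_inter.2 ⟨hie, hi⟩
    have hj' := Finset.mem_inter.2 ⟨hje, hj⟩
    exact ⟨_, (hmem _).2 ⟨e, he, Finset.one_lt_card.2 ⟨i, hi', j, hj', hij⟩, rfl⟩, hi', hj'⟩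

/-- A `d`-set is unlikely to be a clique of the projection without being a hyperedge. -/
lemma hypergraphLaw_real_isClique_le {p : unitInterval} {C δ β : ℝ} (hn : 1 ≤ n) (hC : 1 ≤ C)
    (hp : (p : ℝ) ≤ C * (n : ℝ) ^ (-((d : ℝ) - 1 - δ))) (h : Set.powersetCard (Fin n) d)
    (hβ : ∀ F : Finset (Finset (Fin n)), IsPairCover (h : Finset (Fin n)) F →
      β ≤ ∑ S ∈ F, ((S.card : ℝ) - 1 - δ)) :
    (hypergraphLaw n d p).real
      {x | h ∉ x ∧ (proj x).IsClique ((h : Finset (Fin n)) : Set (Fin n))} ≤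
      2 ^ 2 ^ d * C ^ 2 ^ d * (n : ℝ) ^ (-β) := by
  classical
  have hn0 : (0 : ℝ) < n := by exact_mod_cast hn
  have hn1 : (1 : ℝ) ≤ n := by exact_mod_cast hn
  let 𝓕 := (h : Finset (Fin n)).powerset.powerset.filter fun F => IsPairCover (h : Finset (Fin n)) F
  -- The union bound runs over families of subsets of h, whose number does not depend on n.
  have h𝓕 : 𝓕.card ≤ 2 ^ 2 ^ d := by
    refine (Finset.card_filter_le _ _).trans (le_of_eq ?_)
    rw [Finset.card_powerset, Finset.card_powerset, Set.powersetCard.card_eq]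
  have hsub : {x : UniformHypergraph n d | h ∉ x ∧
      (proj x).IsClique ((h : Finset (Fin n)) : Set (Fin n))} ⊆
      ⋃ F ∈ 𝓕, {x | ∀ S ∈ F, ∃ e ∈ x, (e : Finset (Fin n)) ∩ (h : Finset (Fin n)) = S} := by
    rintro x ⟨hx, hc⟩
    obtain ⟨F, hF, hFx⟩ := exists_isPairCover_of_isClique hx hc
    simp only [Set.mem_iUnion]
    refine ⟨F, Finset.mem_filter.2 ⟨?_, hF⟩, hFx⟩
    exact Finset.mem_powerset.2 fun S hS => Finset.mem_powerset.2 (hF.subset S hS)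
  have hterm : ∀ F ∈ 𝓕, (hypergraphLaw n d p).real
      {x | ∀ S ∈ F, ∃ e ∈ x, (e : Finset (Fin n)) ∩ (h : Finset (Fin n)) = S} ≤
      C ^ 2 ^ d * (n : ℝ) ^ (-β) := by
    intro F hF
    obtain ⟨hFh, hF⟩ := Finset.mem_filter.1 hF
    have hcard : F.card ≤ 2 ^ d := by
      refine (Finset.card_le_card (Finset.mem_powerset.1 hFh)).trans (le_of_eq ?_)
      rw [Finset.card_powerset, Set.powersetCard.card_eq]
    calc _ ≤ ∏ S ∈ F, ((n : ℝ) ^ (d - S.card) * p) := hypergraphLaw_real_traces_le p _ F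
      _ ≤ ∏ S ∈ F, (C * (n : ℝ) ^ (-((S.card : ℝ) - 1 - δ))) := by
          refine Finset.prod_le_prod (fun S _ => mul_nonneg (by positivity) p.2.1) fun S hS => ?_
          have hSd : S.card ≤ d := by
            have := Finset.card_le_card (hF.subset S hS)
            rwa [Set.powersetCard.card_eq] at this
          calc _ ≤ (n : ℝ) ^ (d - S.card) * (C * (n : ℝ) ^ (-((d : ℝ) - 1 - δ))) :=
                mul_le_mul_of_nonneg_left hp (by positivity)
            _ = C * ((n : ℝ) ^ ((d - S.card : ℕ) : ℝ) * (n : ℝ) ^ (-((d : ℝ) - 1 - δ))) := by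
                rw [Real.rpow_natCast]; ring
            _ = _ := by
                rw [← Real.rpow_add hn0, Nat.cast_sub hSd]
                congr 2
                ring
      _ = C ^ F.card * (n : ℝ) ^ (-∑ S ∈ F, ((S.card : ℝ) - 1 - δ)) := by
          rw [Finset.prod_mul_distrib, Finset.prod_const, ← Finset.sum_neg_distrib,
            Real.rpow_sum_of_pos hn0]
      _ ≤ _ := mul_le_mul (pow_le_pow_right₀ hC hcard)
          (Real.rpow_le_rpow_of_exponent_le hn1 (neg_le_neg (hβ F hF))) (by positivity)
          (by positivity)
  calc _ ≤ (hypergraphLaw n d p).real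
        (⋃ F ∈ 𝓕, {x | ∀ S ∈ F, ∃ e ∈ x, (e : Finset (Fin n)) ∩ (h : Finset (Fin n)) = S}) :=
        measureReal_mono hsub (measure_ne_top _ _)
    _ ≤ ∑ F ∈ 𝓕, (hypergraphLaw n d p).real
        {x | ∀ S ∈ F, ∃ e ∈ x, (e : Finset (Fin n)) ∩ (h : Finset (Fin n)) = S} :=
        measureReal_biUnion_finset_le _ _
    _ ≤ 𝓕.card • (C ^ 2 ^ d * (n : ℝ) ^ (-β)) := Finset.sum_le_card_nsmul _ _ _ hterm
    _ ≤ _ := by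
        rw [nsmul_eq_mul, mul_assoc]
        refine mul_le_mul_of_nonneg_right (by exact_mod_cast h𝓕) (by positivity)

end PairCover

/-! ### Orders of growth, and the choice of t in each regime. -/

section Asymptotics

lemma neg_log_one_sub_le {t : ℝ} (h0 : 0 ≤ t) (h1 : t ≤ 1 / 2) : -Real.log (1 - t) ≤ 2 * t := by
  have h := Real.one_sub_inv_le_log_of_pos (by linarith : (0 : ℝ) < 1 - t)
  have h2 : (1 - t)⁻¹ ≤ 1 + 2 * t := by
    rw [inv_le_iff_one_le_mul₀ (by linarith)]
    nlinarith
  linarith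

lemma isBigO_of_eventually_le {f g : ℕ → ℝ} (C : ℝ)
    (h : ∀ᶠ n in atTop, 0 ≤ f n ∧ f n ≤ C * g n) : f =O[atTop] g := by
  refine IsBigO.of_bound |C| ?_
  filter_upwards [h] with n ⟨h0, h1⟩
  rw [Real.norm_of_nonneg h0, Real.norm_eq_abs, ← abs_mul]
  exact h1.trans (le_abs_self _)

lemma le_choose_mul {n d : ℕ} (hn : 2 * d ≤ n) :
    ((2 : ℝ) ^ d * d.factorial)⁻¹ * (n : ℝ) ^ d ≤ n.choose d := by
  refine le_trans ?_ (Nat.pow_le_choose (α := ℝ) d n)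
  have h : (n : ℝ) / 2 ≤ ((n + 1 - d : ℕ) : ℝ) := by
    rw [Nat.cast_sub (by omega)]
    have : (2 : ℝ) * d ≤ n := by exact_mod_cast hn
    push_cast
    linarith
  calc _ = ((n : ℝ) / 2) ^ d / d.factorial := by rw [div_pow]; field_simp
    _ ≤ _ := by gcongr

variable {d : ℕ} {δ c : ℝ} {p : ℕ → unitInterval}

lemma eventually_prob_bounds (hc : 0 < c)
    (hp : Tendsto (fun n : ℕ => (p n : ℝ) / (n : ℝ) ^ (-(d : ℝ) + 1 + δ)) atTop (𝓝 c)) :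
    ∀ᶠ n : ℕ in atTop, c / 2 * (n : ℝ) ^ (-((d : ℝ) - 1 - δ)) ≤ p n ∧
      p n ≤ 2 * c * (n : ℝ) ^ (-((d : ℝ) - 1 - δ)) := by
  have he : -(d : ℝ) + 1 + δ = -((d : ℝ) - 1 - δ) := by ring
  filter_upwards [hp.eventually (eventually_ge_nhds (by linarith : c / 2 < c)),
    hp.eventually (eventually_le_nhds (by linarith : c < 2 * c)), eventually_gt_atTop 0]
    with n h1 h2 hn
  have hpos : (0 : ℝ) < (n : ℝ) ^ (-((d : ℝ) - 1 - δ)) :=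
    Real.rpow_pos_of_pos (by exact_mod_cast hn) _
  rw [he] at h1 h2
  exact ⟨(le_div_iff₀ hpos).1 h1, (div_le_iff₀ hpos).1 h2⟩

lemma tendsto_natCast_rpow_neg {a : ℝ} (ha : 0 < a) :
    Tendsto (fun n : ℕ => (n : ℝ) ^ (-a)) atTop (𝓝 0) :=
  (tendsto_rpow_neg_atTop ha).comp tendsto_natCast_atTop_atTop

lemma tendsto_log_natCast : Tendsto (fun n : ℕ => Real.log n) atTop atTop :=
  Real.tendsto_log_atTop.comp tendsto_natCast_atTop_atTop

lemma natCast_pow_mul_rpow {n : ℕ} (hn : 0 < n) :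
    (n : ℝ) ^ d * (n : ℝ) ^ (-((d : ℝ) - 1 - δ)) = (n : ℝ) ^ (1 + δ) := by
  rw [← Real.rpow_natCast, ← Real.rpow_add (by exact_mod_cast hn)]
  congr 1
  ring

/-- The expected number of hyperedges has order `n ^ (1 + δ)`. -/
lemma eventually_expected_edges_bounds (hc : 0 < c)
    (hp : Tendsto (fun n : ℕ => (p n : ℝ) / (n : ℝ) ^ (-(d : ℝ) + 1 + δ)) atTop (𝓝 c)) :
    ∃ a : ℝ, 0 < a ∧ ∀ᶠ n : ℕ in atTop, a * (n : ℝ) ^ (1 + δ) ≤ (n.choose d : ℝ) * p n ∧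
      (n.choose d : ℝ) * p n ≤ 2 * c * (n : ℝ) ^ (1 + δ) := by
  refine ⟨((2 : ℝ) ^ d * d.factorial)⁻¹ * (c / 2), by positivity, ?_⟩
  filter_upwards [eventually_prob_bounds hc hp, eventually_ge_atTop (2 * d), eventually_gt_atTop 0]
    with n ⟨h1, h2⟩ hn hn0
  have hup : (n.choose d : ℝ) ≤ (n : ℝ) ^ d := by exact_mod_cast Nat.choose_le_pow n d
  rw [← natCast_pow_mul_rpow (d := d) (δ := δ) hn0]
  constructor
  · calc _ = ((2 : ℝ) ^ d * d.factorial)⁻¹ * (n : ℝ) ^ d *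
          (c / 2 * (n : ℝ) ^ (-((d : ℝ) - 1 - δ))) := by ring
      _ ≤ _ := mul_le_mul (le_choose_mul hn) h1 (by positivity) (by positivity)
  · calc _ ≤ (n : ℝ) ^ d * (2 * c * (n : ℝ) ^ (-((d : ℝ) - 1 - δ))) :=
          mul_le_mul hup h2 (p n).2.1 (by positivity)
      _ = _ := by ring

/-- The entropy of the random hypergraph is `(d - 1 - δ) log n + O(1)` per expected hyperedge. -/
lemma eventually_entropy_bounds (hc : 0 < c) (hD : 0 < (d : ℝ) - 1 - δ)
    (hp : Tendsto (fun n : ℕ => (p n : ℝ) / (n : ℝ) ^ (-(d : ℝ) + 1 + δ)) atTop (𝓝 c)) :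
    ∃ B : ℝ, ∀ᶠ n : ℕ in atTop,
      (n.choose d : ℝ) * p n * (((d : ℝ) - 1 - δ) * Real.log n - B) ≤
        entropy (hypergraphLaw n d (p n)) (fun x : UniformHypergraph n d => x) ∧
      entropy (hypergraphLaw n d (p n)) (fun x : UniformHypergraph n d => x) ≤
        (n.choose d : ℝ) * p n * (((d : ℝ) - 1 - δ) * Real.log n + B) := by
  -- The logarithms absorb the constants in the two bounds on p; the 2 pays for (1-p)(-log(1-p)) ≤
  -- 2p.
  refine ⟨|Real.log (2 * c)| + |Real.log (c / 2)| + 2, ?_⟩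
  have hsmall := ((tendsto_natCast_rpow_neg hD).const_mul (2 * c)).eventually
    (eventually_le_nhds (b := 1 / 2) (by norm_num))
  filter_upwards [eventually_prob_bounds hc hp, eventually_gt_atTop 0, hsmall]
    with n ⟨h1, h2⟩ hn hs
  have hn0 : (0 : ℝ) < n := by exact_mod_cast hn
  have hpos : (0 : ℝ) < (n : ℝ) ^ (-((d : ℝ) - 1 - δ)) := Real.rpow_pos_of_pos hn0 _
  have hp0 : 0 < (p n : ℝ) := lt_of_lt_of_le (by positivity) h1
  have hp2 : (p n : ℝ) ≤ 1 / 2 := h2.trans hs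
  have hl1 : Real.log (c / 2) - ((d : ℝ) - 1 - δ) * Real.log n ≤ Real.log (p n) := by
    have := Real.log_le_log (by positivity) h1
    rw [Real.log_mul (by positivity) hpos.ne', Real.log_rpow hn0] at this
    linarith
  have hl2 : Real.log (p n) ≤ Real.log (2 * c) - ((d : ℝ) - 1 - δ) * Real.log n := by
    have := Real.log_le_log hp0 h2
    rw [Real.log_mul (by positivity) hpos.ne', Real.log_rpow hn0] at this
    linarith
  have hq0 : 0 ≤ -Real.log (1 - p n) := neg_nonneg.2 (Real.log_nonpos (by linarith) (by linarith))
  have hq1 : (1 - (p n : ℝ)) * -Real.log (1 - p n) ≤ p n * 2 := by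
    calc _ ≤ 1 * -Real.log (1 - p n) := mul_le_mul_of_nonneg_right (by linarith) hq0
      _ ≤ _ := by linarith [neg_log_one_sub_le hp0.le hp2]
  have hq2 : 0 ≤ (1 - (p n : ℝ)) * -Real.log (1 - p n) := mul_nonneg (by linarith) hq0
  have ha := le_abs_self (Real.log (2 * c))
  have hb := neg_abs_le (Real.log (c / 2))
  have ha' := abs_nonneg (Real.log (2 * c))
  have hb' := abs_nonneg (Real.log (c / 2))
  rw [entropy_hypergraphLaw hp0 (by linarith), mul_assoc, mul_assoc]
  constructor
  · refine mul_le_mul_of_nonneg_left ?_ (Nat.cast_nonneg _)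
    have := mul_le_mul_of_nonneg_left (show ((d : ℝ) - 1 - δ) * Real.log n -
      (|Real.log (2 * c)| + |Real.log (c / 2)| + 2) ≤ -Real.log (p n) by linarith) hp0.le
    linarith
  · refine mul_le_mul_of_nonneg_left ?_ (Nat.cast_nonneg _)
    have := mul_le_mul_of_nonneg_left (show -Real.log (p n) + 2 ≤ ((d : ℝ) - 1 - δ) * Real.log n +
      (|Real.log (2 * c)| + |Real.log (c / 2)| + 2) by linarith) hp0.le
    rw [mul_add] at this
    linarith

/-- The probability that a `d`-set is a clique of the projection without being a hyperedge is
`O(n ^ (-β))` if `β` is a lower bound for the exponents of all pair covers. -/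
lemma eventually_isClique_le (hc : 0 < c)
    (hp : Tendsto (fun n : ℕ => (p n : ℝ) / (n : ℝ) ^ (-(d : ℝ) + 1 + δ)) atTop (𝓝 c)) {β : ℝ}
    (hβ : ∀ (n : ℕ) (h : Finset (Fin n)) (F : Finset (Finset (Fin n))), h.card = d →
      IsPairCover h F → β ≤ ∑ S ∈ F, ((S.card : ℝ) - 1 - δ)) :
    ∃ A : ℝ, 0 < A ∧ ∀ᶠ n : ℕ in atTop, ∀ h : Set.powersetCard (Fin n) d,
      (hypergraphLaw n d (p n)).real
        {x | h ∉ x ∧ (proj x).IsClique ((h : Finset (Fin n)) : Set (Fin n))} ≤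
        A * (n : ℝ) ^ (-β) := by
  have hC : (1 : ℝ) ≤ max 1 (2 * c) := le_max_left _ _
  refine ⟨2 ^ 2 ^ d * max 1 (2 * c) ^ 2 ^ d, by positivity, ?_⟩
  filter_upwards [eventually_prob_bounds hc hp, eventually_ge_atTop 1] with n ⟨_, h2⟩ hn h
  refine hypergraphLaw_real_isClique_le hn hC (h2.trans ?_) h
    fun F hF => hβ n h F (Set.powersetCard.card_eq h) hF
  exact mul_le_mul_of_nonneg_right (le_max_right _ _) (by positivity)

lemma hypergraphCondEntropy_eq (n d : ℕ) (p : unitInterval) :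
    hypergraphCondEntropy n d p =
      entropy (hypergraphLaw n d p) (fun x : UniformHypergraph n d => x) - projEntropy n d p :=
  condEntropy_id _ _

lemma projEntropy_nonneg (n d : ℕ) (p : unitInterval) : 0 ≤ projEntropy n d p :=
  entropy_nonneg _ _

lemma hypergraphCondEntropy_nonneg (n d : ℕ) (p : unitInterval) :
    0 ≤ hypergraphCondEntropy n d p := by
  rw [hypergraphCondEntropy_eq]
  exact sub_nonneg.2 (entropy_le_entropy_id _ _)

/-- A quantity of order at most the entropy of the hypergraph is `O(n ^ (1 + δ) log n)`. -/
lemma isBigO_of_le_entropy (hc : 0 < c) (hD : 0 < (d : ℝ) - 1 - δ)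
    (hp : Tendsto (fun n : ℕ => (p n : ℝ) / (n : ℝ) ^ (-(d : ℝ) + 1 + δ)) atTop (𝓝 c))
    {f : ℕ → ℝ} (h0 : ∀ n, 0 ≤ f n)
    (hf : ∀ n, f n ≤ entropy (hypergraphLaw n d (p n)) (fun x : UniformHypergraph n d => x)) :
    f =O[atTop] fun n : ℕ => (n : ℝ) ^ (1 + δ) * Real.log n := by
  obtain ⟨B, hB⟩ := eventually_entropy_bounds hc hD hp
  obtain ⟨a, -, ha⟩ := eventually_expected_edges_bounds hc hp
  refine isBigO_of_eventually_le (2 * c * ((d : ℝ) - 1 - δ + 1)) ?_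
  filter_upwards [hB, ha, tendsto_log_natCast.eventually_ge_atTop |B|] with n hB ha hL
  refine ⟨h0 n, (hf n).trans (hB.2.trans ?_)⟩
  have hL0 : 0 ≤ Real.log n := (abs_nonneg B).trans hL
  calc _ ≤ n.choose d * (p n : ℝ) * (((d : ℝ) - 1 - δ + 1) * Real.log n) :=
        mul_le_mul_of_nonneg_left (by linarith [le_abs_self B])
          (mul_nonneg (Nat.cast_nonneg _) (p n).2.1)
    _ ≤ 2 * c * (n : ℝ) ^ (1 + δ) * (((d : ℝ) - 1 - δ + 1) * Real.log n) :=
        mul_le_mul_of_nonneg_right ha.2 (mul_nonneg (by linarith) hL0)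
    _ = _ := by ring

/-- Once log n is large, B is at most half of κ log n; the expected number of hyperedges supplies
n^(1+δ). -/
lemma isBigO_of_expected_edges_le (hc : 0 < c)
    (hp : Tendsto (fun n : ℕ => (p n : ℝ) / (n : ℝ) ^ (-(d : ℝ) + 1 + δ)) atTop (𝓝 c))
    {f : ℕ → ℝ} {κ B : ℝ} (hκ : 0 < κ)
    (hf : ∀ᶠ n : ℕ in atTop, (n.choose d : ℝ) * p n * (κ * Real.log n - B) ≤ f n) :
    (fun n : ℕ => (n : ℝ) ^ (1 + δ) * Real.log n) =O[atTop] f := by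
  obtain ⟨a, ha0, ha⟩ := eventually_expected_edges_bounds hc hp
  refine isBigO_of_eventually_le (a * (κ / 2))⁻¹ ?_
  filter_upwards [hf, ha, tendsto_log_natCast.eventually_ge_atTop (|B| / (κ / 2))] with n hf ha hL
  have hL' : |B| ≤ κ / 2 * Real.log n := by
    rw [div_le_iff₀ (by positivity)] at hL
    linarith
  have hL0 : 0 ≤ Real.log n := le_trans (by positivity) hL
  refine ⟨by positivity, ?_⟩
  rw [inv_mul_eq_div, le_div_iff₀ (by positivity)]
  calc _ = a * (n : ℝ) ^ (1 + δ) * (κ / 2 * Real.log n) := by ring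
    _ ≤ (n.choose d : ℝ) * p n * (κ / 2 * Real.log n) :=
        mul_le_mul_of_nonneg_right ha.1 (by positivity)
    _ ≤ (n.choose d : ℝ) * p n * (κ * Real.log n - B) :=
        mul_le_mul_of_nonneg_left (by linarith [le_abs_self B])
          (mul_nonneg (Nat.cast_nonneg _) (p n).2.1)
    _ ≤ _ := hf

/-- Comparison of the clique probability with the edge probability. -/
lemma eventually_isClique_le_mul (hc : 0 < c)
    (hp : Tendsto (fun n : ℕ => (p n : ℝ) / (n : ℝ) ^ (-(d : ℝ) + 1 + δ)) atTop (𝓝 c)) {γ : ℝ}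
    (hγ : ∀ (n : ℕ) (h : Finset (Fin n)) (F : Finset (Finset (Fin n))), h.card = d →
      IsPairCover h F → (d : ℝ) - 1 - δ + γ ≤ ∑ S ∈ F, ((S.card : ℝ) - 1 - δ)) :
    ∃ A : ℝ, 0 < A ∧ ∀ᶠ n : ℕ in atTop, ∀ h : Set.powersetCard (Fin n) d,
      (hypergraphLaw n d (p n)).real
        {x | h ∉ x ∧ (proj x).IsClique ((h : Finset (Fin n)) : Set (Fin n))} ≤
        A * (n : ℝ) ^ (-γ) * p n := by
  obtain ⟨A, hA, h⟩ := eventually_isClique_le hc hp hγ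
  refine ⟨A * (c / 2)⁻¹, by positivity, ?_⟩
  filter_upwards [h, eventually_prob_bounds hc hp, eventually_gt_atTop 0] with n h ⟨h1, _⟩ hn x
  refine (h x).trans ?_
  have hn0 : (0 : ℝ) < n := by exact_mod_cast hn
  rw [neg_add, Real.rpow_add hn0]
  calc _ = A * (c / 2)⁻¹ * (n : ℝ) ^ (-γ) * (c / 2 * (n : ℝ) ^ (-((d : ℝ) - 1 - δ))) := by
        field_simp
    _ ≤ _ := mul_le_mul_of_nonneg_left h1 (by positivity)

theorem projEntropy_isTheta (hd : 3 ≤ d) (hδ : δ < 1) (hc : 0 < c)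
    (hp : Tendsto (fun n : ℕ => (p n : ℝ) / (n : ℝ) ^ (-(d : ℝ) + 1 + δ)) atTop (𝓝 c)) :
    (fun n : ℕ => projEntropy n d (p n)) =Θ[atTop] fun n : ℕ => (n : ℝ) ^ (1 + δ) * Real.log n := by
  have hd' : (3 : ℝ) ≤ d := by exact_mod_cast hd
  have hD : 0 < (d : ℝ) - 1 - δ := by linarith
  refine ⟨isBigO_of_le_entropy hc hD hp (fun n => projEntropy_nonneg n d _)
    fun n => entropy_le_entropy_id _ _, ?_⟩
  -- With γ = -(d-2) the required exponent d-1-δ+γ is the crude 1-δ.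
  obtain ⟨A, hA, hq⟩ := eventually_isClique_le_mul (γ := -((d : ℝ) - 2)) hc hp
    fun n h F hh hF => by linarith [hF.one_sub_le_sum (by omega) hδ]
  obtain ⟨B, hB⟩ := eventually_entropy_bounds hc hD hp
  refine isBigO_of_expected_edges_le (κ := 1 - δ) (B := B + 2 * A) hc hp (by linarith) ?_
  have hsmall := (tendsto_natCast_rpow_neg (by linarith : 0 < (d : ℝ) - 2)).eventually
    (eventually_le_nhds (b := 1 / 2) (by norm_num))
  filter_upwards [hq, hB, hsmall, eventually_gt_atTop 0] with n hq hB ht hn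
  have hn0 : (0 : ℝ) < n := by exact_mod_cast hn
  -- This t cancels the factor n^(d-2) in the clique bound, so the non-hyperedge cliques cost only
  -- O(p) per d-set.
  set t : ℝ := (n : ℝ) ^ (-((d : ℝ) - 2)) with ht_def
  have ht0 : 0 < t := Real.rpow_pos_of_pos hn0 _
  have hlog : -Real.log t = ((d : ℝ) - 2) * Real.log n := by
    rw [ht_def, Real.log_rpow hn0]; ring
  have hle := hypergraphCondEntropy_le (p n) ht0 (by linarith) hq
  rw [hypergraphCondEntropy_eq, neg_neg, hlog] at hle
  have hinv : (n : ℝ) ^ ((d : ℝ) - 2) * t = 1 := by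
    rw [ht_def, ← Real.rpow_add hn0]; simp
  have hp0 : 0 ≤ (p n : ℝ) := (p n).2.1
  have h2 : A * (n : ℝ) ^ ((d : ℝ) - 2) * p n * -Real.log (1 - t) ≤ p n * (2 * A) := by
    calc _ ≤ A * (n : ℝ) ^ ((d : ℝ) - 2) * p n * (2 * t) :=
          mul_le_mul_of_nonneg_left (neg_log_one_sub_le ht0.le ht) (by positivity)
      _ = 2 * A * p n * ((n : ℝ) ^ ((d : ℝ) - 2) * t) := by ring
      _ = _ := by rw [hinv]; ring
  have h3 := mul_le_mul_of_nonneg_left h2 (Nat.cast_nonneg (α := ℝ) (n.choose d))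
  have h4 := hB.1
  rw [mul_add] at hle
  linear_combination h3 + h4 + hle

theorem hypergraphCondEntropy_isLittleO (hd : 3 ≤ d) (hc : 0 < c)
    (hp : Tendsto (fun n : ℕ => (p n : ℝ) / (n : ℝ) ^ (-(d : ℝ) + 1 + δ)) atTop (𝓝 c))
    (hδ : δ < ((d : ℝ) - 1) / ((d : ℝ) + 1)) :
    (fun n : ℕ => hypergraphCondEntropy n d (p n)) =o[atTop] fun n : ℕ => (n : ℝ) ^ (1 + δ) := by
  have hthr : ((d : ℝ) - 1) / (d + 1) = 1 - 2 / (d + 1) := by field_simp; ring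
  have hγ : 0 < 1 - δ - 2 / ((d : ℝ) + 1) := by linarith
  obtain ⟨A, hA, hq⟩ := eventually_isClique_le_mul (γ := 1 - δ - 2 / ((d : ℝ) + 1)) hc hp
    fun n h F hh hF => by
      subst hh
      exact hF.le_sum (by omega) (by linarith)
  obtain ⟨a, -, ha⟩ := eventually_expected_edges_bounds hc hp
  rw [isLittleO_iff]
  intro ε hε
  -- Chosen so that 2c · 2ε' = ε. With t = exp(-ε') each hyperedge costs ε', and the cliques cost at
  -- most another ε' because n^(-γ) tends to 0.
  set ε' : ℝ := ε / (4 * c) with hε'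
  have hε'0 : 0 < ε' := by positivity
  have ht1 : Real.exp (-ε') < 1 := Real.exp_lt_one_iff.2 (by linarith)
  have hsmall := (((tendsto_natCast_rpow_neg hγ).const_mul A).mul_const
    (-Real.log (1 - Real.exp (-ε')))).eventually (eventually_le_nhds (b := ε') (by simpa))
  filter_upwards [hq, ha, hsmall] with n hq ha hs
  have hle := hypergraphCondEntropy_le (p n) (Real.exp_pos _) ht1 hq
  rw [Real.log_exp, neg_neg] at hle
  rw [Real.norm_of_nonneg (hypergraphCondEntropy_nonneg _ _ _),
    Real.norm_of_nonneg (by positivity)]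
  refine hle.trans ?_
  have hNp : 0 ≤ n.choose d * (p n : ℝ) := mul_nonneg (Nat.cast_nonneg _) (p n).2.1
  calc _ = n.choose d * (p n : ℝ) * (ε' + A * (n : ℝ) ^ (-(1 - δ - 2 / ((d : ℝ) + 1))) *
        -Real.log (1 - Real.exp (-ε'))) := by ring
    _ ≤ n.choose d * (p n : ℝ) * (2 * ε') := mul_le_mul_of_nonneg_left (by linarith) hNp
    _ ≤ 2 * c * (n : ℝ) ^ (1 + δ) * (2 * ε') := mul_le_mul_of_nonneg_right ha.2 (by positivity)
    _ = _ := by rw [hε']; field_simp; ring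

theorem hypergraphCondEntropy_isBigO (hd : 3 ≤ d) (hc : 0 < c)
    (hp : Tendsto (fun n : ℕ => (p n : ℝ) / (n : ℝ) ^ (-(d : ℝ) + 1 + δ)) atTop (𝓝 c))
    (hδ : δ ≤ ((d : ℝ) - 1) / ((d : ℝ) + 1)) :
    (fun n : ℕ => hypergraphCondEntropy n d (p n)) =O[atTop] fun n : ℕ => (n : ℝ) ^ (1 + δ) := by
  have hthr : ((d : ℝ) - 1) / (d + 1) = 1 - 2 / (d + 1) := by field_simp; ring
  obtain ⟨A, hA, hq⟩ := eventually_isClique_le_mul (γ := 0) hc hp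
    fun n h F hh hF => by
      subst hh
      linarith [hF.le_sum (δ := δ) (by omega) (by linarith)]
  obtain ⟨a, -, ha⟩ := eventually_expected_edges_bounds hc hp
  refine isBigO_of_eventually_le (2 * c * ((1 + A) * Real.log 2)) ?_
  filter_upwards [hq, ha] with n hq ha
  refine ⟨hypergraphCondEntropy_nonneg _ _ _, ?_⟩
  refine (hypergraphCondEntropy_le (p n) (t := 1 / 2) (by norm_num) (by norm_num) hq).trans ?_
  have h2 : -Real.log (1 / 2) = Real.log 2 := by rw [one_div, Real.log_inv, neg_neg]
  have h3 : (1 : ℝ) - 1 / 2 = 1 / 2 := by norm_num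
  rw [h3, h2, neg_zero, Real.rpow_zero, mul_one]
  calc _ = n.choose d * (p n : ℝ) * ((1 + A) * Real.log 2) := by ring
    _ ≤ 2 * c * (n : ℝ) ^ (1 + δ) * ((1 + A) * Real.log 2) :=
        mul_le_mul_of_nonneg_right ha.2 (mul_nonneg (by linarith) (Real.log_nonneg (by norm_num)))
    _ = _ := by ring

theorem hypergraphCondEntropy_isTheta (hd : 3 ≤ d) (hδ1 : δ < 1) (hc : 0 < c)
    (hp : Tendsto (fun n : ℕ => (p n : ℝ) / (n : ℝ) ^ (-(d : ℝ) + 1 + δ)) atTop (𝓝 c))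
    (hδ : ((d : ℝ) - 1) / ((d : ℝ) + 1) < δ) :
    (fun n : ℕ => hypergraphCondEntropy n d (p n))
      =Θ[atTop] fun n : ℕ => (n : ℝ) ^ (1 + δ) * Real.log n := by
  have hd' : (3 : ℝ) ≤ d := by exact_mod_cast hd
  have hD : 0 < (d : ℝ) - 1 - δ := by linarith
  refine ⟨isBigO_of_le_entropy hc hD hp (fun n => hypergraphCondEntropy_nonneg n d _)
    fun n => ?_, ?_⟩
  · rw [hypergraphCondEntropy_eq]
    linarith [projEntropy_nonneg n d (p n)]
  obtain ⟨B, hB⟩ := eventually_entropy_bounds hc hD hp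
  obtain ⟨a, ha0, ha⟩ := eventually_expected_edges_bounds hc hp
  -- Twice this quantity is (d-2)((d+1)δ - (d-1)), so its sign is decided by the threshold.
  have hκ : 0 < (d : ℝ) - 1 - δ - d.choose 2 * (1 - δ) := by
    rw [Nat.cast_choose_two]
    rw [div_lt_iff₀ (by linarith)] at hδ
    nlinarith [mul_pos (by linarith : (0 : ℝ) < d - 2) (sub_pos.2 hδ)]
  refine isBigO_of_expected_edges_le (B := B + 2 * a⁻¹) hc hp hκ ?_
  have hsmall := (tendsto_natCast_rpow_neg (by linarith : 0 < 1 - δ)).eventually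
    (eventually_le_nhds (b := 1 / 2) (by norm_num))
  filter_upwards [hB, ha, hsmall, eventually_gt_atTop 0] with n hB ha ht hn
  have hn0 : (0 : ℝ) < n := by exact_mod_cast hn
  -- With this density n² t = n^(1+δ), so the non-edges of Ψ cost only O(1) per expected hyperedge.
  set t : ℝ := (n : ℝ) ^ (-(1 - δ)) with ht_def
  have ht0 : 0 < t := Real.rpow_pos_of_pos hn0 _
  have hlog : -Real.log t = (1 - δ) * Real.log n := by
    rw [ht_def, Real.log_rpow hn0]; ring
  have hle := projEntropy_le (n := n) (d := d) (p n) ht0 (by linarith)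
  rw [hlog] at hle
  have h2 : (n.choose 2 : ℝ) * -Real.log (1 - t) ≤ (n.choose d : ℝ) * p n * (2 * a⁻¹) := by
    have hup : (n.choose 2 : ℝ) ≤ (n : ℝ) ^ 2 := by exact_mod_cast Nat.choose_le_pow n 2
    have hn2 : (n : ℝ) ^ 2 * t = (n : ℝ) ^ (1 + δ) := by
      rw [ht_def, ← Real.rpow_natCast, ← Real.rpow_add hn0]
      congr 1
      push_cast
      ring
    calc _ ≤ (n : ℝ) ^ 2 * (2 * t) := mul_le_mul hup (neg_log_one_sub_le ht0.le ht)
          (neg_nonneg.2 (Real.log_nonpos (by linarith) (by linarith))) (by positivity)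
      _ = a * (n : ℝ) ^ (1 + δ) * (2 * a⁻¹) := by rw [← hn2]; field_simp
      _ ≤ _ := mul_le_mul_of_nonneg_right ha.1 (by positivity)
  rw [hypergraphCondEntropy_eq]
  linear_combination h2 + hle + hB.1

end Asymptotics

end HypergraphProjection

theorem mainTheorem11 (d : ℕ) (hd : 3 ≤ d) (δ : ℝ) (hδ : δ < 1) (c : ℝ) (hc : 0 < c)
    (p : ℕ → unitInterval)
    (hp : Tendsto (fun n : ℕ => (p n : ℝ) / (n : ℝ) ^ (-(d : ℝ) + 1 + δ)) atTop (𝓝 c)) :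
    ((fun n : ℕ => HypergraphProjection.projEntropy n d (p n))
        =Θ[atTop] fun n : ℕ => (n : ℝ) ^ (1 + δ) * Real.log n) ∧
    (δ < ((d : ℝ) - 1) / ((d : ℝ) + 1) →
      (fun n : ℕ => HypergraphProjection.hypergraphCondEntropy n d (p n))
        =o[atTop] fun n : ℕ => (n : ℝ) ^ (1 + δ)) ∧
    (δ = ((d : ℝ) - 1) / ((d : ℝ) + 1) →
      (fun n : ℕ => HypergraphProjection.hypergraphCondEntropy n d (p n))
        =O[atTop] fun n : ℕ => (n : ℝ) ^ (1 + δ)) ∧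
    (((d : ℝ) - 1) / ((d : ℝ) + 1) < δ →
      (fun n : ℕ => HypergraphProjection.hypergraphCondEntropy n d (p n))
        =Θ[atTop] fun n : ℕ => (n : ℝ) ^ (1 + δ) * Real.log n) :=
  ⟨HypergraphProjection.projEntropy_isTheta hd hδ hc hp,
    HypergraphProjection.hypergraphCondEntropy_isLittleO hd hc hp,
    fun h => HypergraphProjection.hypergraphCondEntropy_isBigO hd hc hp h.le,
    HypergraphProjection.hypergraphCondEntropy_isTheta hd hδ hc hp⟩
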